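/- Let $\mathcal H$ be a complex Hilbert space, $U$ a unitary and $P$ an orthogonal projection on $\mathcal H$ such that $A = UPU^* - P$ is compact. Suppose $\tau$ is an odd time-reversal symmetry, i.e. an anti-unitary operator on $\mathcal H$ with $\tau^2 = -1$, such that $\tau U\tau^* = U^*$ and $\tau P\tau^* = P$. Then there exists a unitary $W$, of the form $W = VU$ with $V$ unitary, such that $U - W$ is compact, $\tau W\tau^* = W^*$, and: - if $\dim\ker(A - 1)$ is even, then $WPW^* - P = 0$; - if $\dim\ker(A - 1)$ is odd, then $WPW^* - P = \Pi_+ - \Pi_-$ for some orthogonal projections $\Pi_+$ and $\Pi_-$ with one-dimensional range. Moreover, for this same $W$ and every $0 < p < \infty$: if the commutator $[U,P] = UP - PU$ belongs to the Schatten-$p$ class, then so does $U - W$. -/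

import Mathlib

/-- The conjugate `τ T τ*` of a bounded operator `T` by an anti-unitary operator `τ`, i.e. a
surjective conjugate-linear isometry; the adjoint `τ*` of an anti-unitary operator is its inverse. -/
noncomputable def antiunitaryConj {H : Type*} [NormedAddCommGroup H] [InnerProductSpace ℂ H]
    (τ : H ≃ₛₗᵢ[starRingEnd ℂ] H) (T : H →L[ℂ] H) : H →L[ℂ] H :=
  (τ : H →SL[starRingEnd ℂ] H).comp (T.comp (τ.symm : H →SL[starRingEnd ℂ] H))

/-- An odd time-reversal symmetry: an anti-unitary operator `τ` with `τ² = -1`. -/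
def IsOddTimeReversal {H : Type*} [NormedAddCommGroup H] [InnerProductSpace ℂ H]
    (τ : H ≃ₛₗᵢ[starRingEnd ℂ] H) : Prop :=
  ∀ x : H, τ (τ x) = -x

/-- The `n`-th singular number (numbered from `0`) of a bounded operator on a Hilbert space, as
its distance to the operators of rank at most `n`. For compact `T` this is the `n`-th
eigenvalue of `|T| = (T* T)^(1/2)`, in decreasing order and with multiplicity. -/
noncomputable def singularNumber {H : Type*} [NormedAddCommGroup H] [InnerProductSpace ℂ H]
    (T : H →L[ℂ] H) (n : ℕ) : ℝ :=
  ⨅ F : {F : H →L[ℂ] H // (F : H →ₗ[ℂ] H).rank ≤ (n : Cardinal)}, ‖T - F.1‖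

/-- `T` belongs to the Schatten-`p` class (`0 < p < ∞`): the `p`-th powers of its singular numbers
are summable. As the singular numbers then tend to `0`, such a `T` is compact. -/
def IsSchatten {H : Type*} [NormedAddCommGroup H] [InnerProductSpace ℂ H]
    (p : ℝ) (T : H →L[ℂ] H) : Prop :=
  Summable fun n : ℕ => singularNumber T n ^ p

/-- `R` is an orthogonal projection with one-dimensional range. -/
def IsOneDimProjection {H : Type*} [NormedAddCommGroup H] [InnerProductSpace ℂ H]
    [CompleteSpace H] (R : H →L[ℂ] H) : Prop :=
  IsStarProjection R ∧ Module.finrank ℂ (R : H →ₗ[ℂ] H).range = 1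

/-! ### Approximation numbers, and the Schatten and compact ideals. -/

section SingularNumbers

variable {H : Type*} [NormedAddCommGroup H] [InnerProductSpace ℂ H]

/-! Put `σ = Uτ` and `Q = UPU*`. Then `σ` is again odd and exchanges `P` and `Q`, so `σAσ* = -A`. It
suffices to find a unitary `V` with `σVσ* = V*` that carries `Q` to `P` up to the allowed error.

If `ker(A - 1) = 0`, this symmetry also excludes the eigenvalue `-1`, so `1 - A²` is invertible and
Kato's unitary `(1 - A²)^(-1/2) (PQ + (1 - P)(1 - Q))` works
(`exists_unitary_intertwining_of_isUnit`). In general a reflection `R` commuting with `σ` removes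
two dimensions from the kernel when `σ` is replaced by `Rσ` (`exists_twist_ker_eq`); `σ² = -1` is
what makes such pairs available. Induction leaves dimension 0 or 1, and in the latter case splitting
off one vector from each projection gives the rank-one error terms.

Throughout, `V - 1` stays in every two-sided ideal containing `A` and the rank-one operators, which
gives compactness and all Schatten classes at once. -/

lemma singularNumber_le {T F : H →L[ℂ] H} {n : ℕ}
    (hF : (F : H →ₗ[ℂ] H).rank ≤ (n : Cardinal)) : singularNumber T n ≤ ‖T - F‖ :=
  ciInf_le (f := fun F : {F : H →L[ℂ] H // (F : H →ₗ[ℂ] H).rank ≤ (n : Cardinal)} => ‖T - F.1‖)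
    ⟨0, by rintro _ ⟨F, rfl⟩; exact norm_nonneg _⟩ ⟨F, hF⟩

lemma le_singularNumber {T : H →L[ℂ] H} {n : ℕ} {c : ℝ}
    (h : ∀ F : H →L[ℂ] H, (F : H →ₗ[ℂ] H).rank ≤ (n : Cardinal) → c ≤ ‖T - F‖) :
    c ≤ singularNumber T n := by
  have : Nonempty {F : H →L[ℂ] H // (F : H →ₗ[ℂ] H).rank ≤ (n : Cardinal)} :=
    ⟨⟨0, by rw [ContinuousLinearMap.toLinearMap_zero, LinearMap.rank_zero]; exact zero_le⟩⟩
  exact le_ciInf fun F => h F.1 F.2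

lemma singularNumber_nonneg (T : H →L[ℂ] H) (n : ℕ) : 0 ≤ singularNumber T n :=
  le_singularNumber fun _ _ => norm_nonneg _

lemma singularNumber_anti (T : H →L[ℂ] H) : Antitone (singularNumber T) := fun _ _ h =>
  le_singularNumber fun _ hF => singularNumber_le (hF.trans (by exact_mod_cast h))

lemma singularNumber_add_le (S T : H →L[ℂ] H) (m n : ℕ) :
    singularNumber (S + T) (m + n) ≤ singularNumber S m + singularNumber T n := by
  rw [← sub_le_iff_le_add]
  refine le_singularNumber fun F hF => ?_
  rw [sub_le_comm]
  refine le_singularNumber fun G hG => ?_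
  rw [sub_le_iff_le_add]
  refine (singularNumber_le (F := F + G) ?_).trans ?_
  · rw [ContinuousLinearMap.toLinearMap_add]
    exact (LinearMap.rank_add_le _ _).trans (by push_cast; gcongr)
  · rw [add_sub_add_comm, add_comm ‖T - G‖]
    exact norm_add_le _ _

lemma singularNumber_mul_left_le (S T : H →L[ℂ] H) (n : ℕ) :
    singularNumber (S * T) n ≤ ‖S‖ * singularNumber T n := by
  rcases (norm_nonneg S).eq_or_lt' with h | h
  · rw [h, zero_mul]
    refine (singularNumber_le (F := 0) ?_).trans ?_
    · rw [ContinuousLinearMap.toLinearMap_zero, LinearMap.rank_zero]; exact zero_le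
    · simp [norm_eq_zero.1 h]
  · rw [← div_le_iff₀' h]
    refine le_singularNumber fun F hF => ?_
    rw [div_le_iff₀' h]
    refine (singularNumber_le (F := S * F)
      ((LinearMap.rank_comp_le_right (F : H →ₗ[ℂ] H) (S : H →ₗ[ℂ] H)).trans hF)).trans ?_
    rw [← mul_sub]
    exact norm_mul_le _ _

lemma singularNumber_mul_right_le (S T : H →L[ℂ] H) (n : ℕ) :
    singularNumber (S * T) n ≤ singularNumber S n * ‖T‖ := by
  rcases (norm_nonneg T).eq_or_lt' with h | h
  · rw [h, mul_zero]
    refine (singularNumber_le (F := 0) ?_).trans ?_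
    · rw [ContinuousLinearMap.toLinearMap_zero, LinearMap.rank_zero]; exact zero_le
    · simp [norm_eq_zero.1 h]
  · rw [← div_le_iff₀ h]
    refine le_singularNumber fun F hF => ?_
    rw [div_le_iff₀ h]
    refine (singularNumber_le (F := F * T)
      ((LinearMap.rank_comp_le_left (T : H →ₗ[ℂ] H) (F : H →ₗ[ℂ] H)).trans hF)).trans ?_
    rw [← sub_mul]
    exact norm_mul_le _ _

lemma singularNumber_neg (T : H →L[ℂ] H) (n : ℕ) :
    singularNumber (-T) n = singularNumber T n := by
  have key : ∀ S : H →L[ℂ] H, singularNumber (-S) n ≤ singularNumber S n := fun S =>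
    le_singularNumber fun F hF =>
      (singularNumber_le (F := -F) (by
        rw [ContinuousLinearMap.toLinearMap_neg, LinearMap.rank, LinearMap.range_neg]
        exact hF)).trans (by rw [neg_sub_neg, norm_sub_rev])
  exact le_antisymm (key T) (by simpa using key (-T))

lemma singularNumber_eq_zero_of_rank_le {T : H →L[ℂ] H} {n : ℕ}
    (hT : (T : H →ₗ[ℂ] H).rank ≤ (n : Cardinal)) : singularNumber T n = 0 :=
  le_antisymm ((singularNumber_le hT).trans (by simp)) (singularNumber_nonneg _ _)

lemma IsSchatten.of_rank_le {p : ℝ} (hp : 0 < p) {T : H →L[ℂ] H} {n : ℕ}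
    (hT : (T : H →ₗ[ℂ] H).rank ≤ (n : Cardinal)) : IsSchatten p T := by
  refine summable_of_ne_finset_zero (s := Finset.range n) fun m hm => ?_
  rw [singularNumber_eq_zero_of_rank_le (hT.trans (by simpa using hm)), Real.zero_rpow hp.ne']

lemma IsSchatten.of_le {p : ℝ} (hp : 0 < p) {S T : H →L[ℂ] H} (hT : IsSchatten p T) (c : ℝ)
    (hc : 0 ≤ c) (h : ∀ n, singularNumber S n ≤ c * singularNumber T n) : IsSchatten p S := by
  refine Summable.of_nonneg_of_le (fun n => Real.rpow_nonneg (singularNumber_nonneg S n) p)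
    (fun n => ?_) (hT.mul_left (c ^ p))
  rw [← Real.mul_rpow hc (singularNumber_nonneg T n)]
  exact Real.rpow_le_rpow (singularNumber_nonneg S n) (h n) hp.le

/-- The terms of index `2n` and `2n + 1` are both controlled by the `n`-th singular numbers of `S`
and `T`. Bounding a sum by twice the maximum avoids convexity, so `p < 1` is covered. -/
lemma IsSchatten.add {p : ℝ} (hp : 0 < p) {S T : H →L[ℂ] H} (hS : IsSchatten p S)
    (hT : IsSchatten p T) : IsSchatten p (S + T) := by
  have hdom : Summable fun n : ℕ =>
      (2 : ℝ) ^ p * (singularNumber S n ^ p + singularNumber T n ^ p) :=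
    (Summable.add hS hT).mul_left _
  have key : ∀ n m : ℕ, n + n ≤ m → singularNumber (S + T) m ^ p ≤
      2 ^ p * (singularNumber S n ^ p + singularNumber T n ^ p) := by
    intro n m hm
    have hs := singularNumber_nonneg S n
    have ht := singularNumber_nonneg T n
    have h1 : singularNumber (S + T) m ≤ 2 * max (singularNumber S n) (singularNumber T n) := by
      have := (singularNumber_anti (S + T) hm).trans (singularNumber_add_le S T n n)
      linarith [le_max_left (singularNumber S n) (singularNumber T n),
        le_max_right (singularNumber S n) (singularNumber T n)]
    refine (Real.rpow_le_rpow (singularNumber_nonneg _ _) h1 hp.le).trans ?_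
    rw [Real.mul_rpow zero_le_two (le_max_of_le_left hs)]
    gcongr
    have := Real.rpow_nonneg hs p
    have := Real.rpow_nonneg ht p
    rcases max_choice (singularNumber S n) (singularNumber T n) with h | h <;> rw [h] <;> linarith
  refine Summable.even_add_odd (f := fun n => singularNumber (S + T) n ^ p) ?_ ?_
  · exact Summable.of_nonneg_of_le (fun n => Real.rpow_nonneg (singularNumber_nonneg _ _) p)
      (fun n => key n _ (by omega)) hdom
  · exact Summable.of_nonneg_of_le (fun n => Real.rpow_nonneg (singularNumber_nonneg _ _) p)
      (fun n => key n _ (by omega)) hdom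

/-- The Schatten-`p` class as a two-sided ideal. -/
noncomputable def schattenIdeal (H : Type*) [NormedAddCommGroup H] [InnerProductSpace ℂ H]
    (p : ℝ) (hp : 0 < p) : TwoSidedIdeal (H →L[ℂ] H) :=
  TwoSidedIdeal.mk' {T | IsSchatten p T}
    (IsSchatten.of_rank_le (n := 0) hp (by
      rw [ContinuousLinearMap.toLinearMap_zero, LinearMap.rank_zero]; exact zero_le))
    (fun hS hT => IsSchatten.add hp hS hT)
    (fun {T} hT => IsSchatten.of_le hp hT 1 zero_le_one fun n => by rw [singularNumber_neg, one_mul])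
    (fun {S _} hT => IsSchatten.of_le hp hT ‖S‖ (norm_nonneg S) (singularNumber_mul_left_le S _))
    (fun {_ T} hS => IsSchatten.of_le hp hS ‖T‖ (norm_nonneg T) fun n =>
      (singularNumber_mul_right_le _ T n).trans (mul_comm _ _).le)

lemma mem_schattenIdeal {p : ℝ} {hp : 0 < p} {T : H →L[ℂ] H} :
    T ∈ schattenIdeal H p hp ↔ IsSchatten p T :=
  TwoSidedIdeal.mem_mk' ..

lemma rankOne_mem_schattenIdeal {p : ℝ} (hp : 0 < p) (x y : H) :
    InnerProductSpace.rankOne ℂ x y ∈ schattenIdeal H p hp := by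
  refine mem_schattenIdeal.2 (IsSchatten.of_rank_le (n := 1) hp ?_)
  rw [InnerProductSpace.toLinearMap_rankOne]
  refine (Submodule.rank_mono (t := Submodule.span ℂ {x}) ?_).trans
    ((rank_span_le _).trans (by simp))
  rintro _ ⟨z, rfl⟩
  exact Submodule.smul_mem _ _ (Submodule.mem_span_singleton_self x)

/-- The compact operators as a two-sided ideal. -/
def compactIdeal (H : Type*) [NormedAddCommGroup H] [InnerProductSpace ℂ H] :
    TwoSidedIdeal (H →L[ℂ] H) :=
  TwoSidedIdeal.mk' {T | IsCompactOperator T} isCompactOperator_zero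
    (fun hS hT => IsCompactOperator.add hS hT) (fun hT => IsCompactOperator.neg hT)
    (fun {S _} hT => IsCompactOperator.clm_comp hT S)
    (fun {_ T} hS => IsCompactOperator.comp_clm hS T)

lemma mem_compactIdeal {T : H →L[ℂ] H} : T ∈ compactIdeal H ↔ IsCompactOperator T :=
  TwoSidedIdeal.mem_mk' ..

lemma rankOne_mem_compactIdeal (x y : H) :
    InnerProductSpace.rankOne ℂ x y ∈ compactIdeal H := by
  rw [mem_compactIdeal, InnerProductSpace.rankOne_def']
  exact (isCompactOperator_of_locallyCompactSpace_rng
    (ContinuousLinearMap.toSpanSingleton ℂ x)).comp_clm (innerSL ℂ y)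

end SingularNumbers

/-! ### Conjugation by anti-unitary operators. -/

section AntiunitaryConj

variable {H : Type*} [NormedAddCommGroup H] [InnerProductSpace ℂ H]
  (σ : H ≃ₛₗᵢ[starRingEnd ℂ] H)

@[simp] lemma antiunitaryConj_apply (T : H →L[ℂ] H) (x : H) :
    antiunitaryConj σ T x = σ (T (σ.symm x)) := rfl

lemma antiunitaryConj_one : antiunitaryConj σ 1 = 1 := by
  ext x; simp

lemma antiunitaryConj_mul (S T : H →L[ℂ] H) :
    antiunitaryConj σ (S * T) = antiunitaryConj σ S * antiunitaryConj σ T := by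
  ext x; simp

lemma antiunitaryConj_add (S T : H →L[ℂ] H) :
    antiunitaryConj σ (S + T) = antiunitaryConj σ S + antiunitaryConj σ T := by
  ext x; simp

lemma antiunitaryConj_sub (S T : H →L[ℂ] H) :
    antiunitaryConj σ (S - T) = antiunitaryConj σ S - antiunitaryConj σ T := by
  ext x; simp

/-- Polarization: norms determine the real part, and replacing `y` by `iy` gives the imaginary part.
-/
lemma antiunitary_inner_map_map (x y : H) : inner ℂ (σ x) (σ y) = inner ℂ y x := by
  have hre : ∀ x y : H, (inner ℂ (σ x) (σ y)).re = (inner ℂ y x).re := by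
    intro x y
    have h1 := norm_add_sq (𝕜 := ℂ) (σ x) (σ y)
    have h2 := norm_add_sq (𝕜 := ℂ) y x
    rw [← map_add, σ.norm_map, σ.norm_map, σ.norm_map, add_comm x y] at h1
    simp only [RCLike.re_to_complex] at h1 h2
    linarith
  refine Complex.ext (hre x y) ?_
  have h := hre x (Complex.I • y)
  rw [map_smulₛₗ, inner_smul_right, inner_smul_left] at h
  simpa using h

lemma antiunitary_inner_symm_left (x y : H) : inner ℂ (σ.symm x) y = inner ℂ (σ y) x := by
  rw [← antiunitary_inner_map_map σ, σ.apply_symm_apply]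

lemma antiunitaryConj_star [CompleteSpace H] (T : H →L[ℂ] H) :
    antiunitaryConj σ (star T) = star (antiunitaryConj σ T) := by
  rw [ContinuousLinearMap.star_eq_adjoint, ContinuousLinearMap.star_eq_adjoint,
    ContinuousLinearMap.eq_adjoint_iff]
  intro x y
  rw [antiunitaryConj_apply, antiunitaryConj_apply]
  conv_lhs => rw [← σ.apply_symm_apply y, antiunitary_inner_map_map]
  conv_rhs => rw [← σ.apply_symm_apply x, antiunitary_inner_map_map]
  rw [ContinuousLinearMap.adjoint_inner_right]

lemma antiunitaryConj_rankOne (x y : H) :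
    antiunitaryConj σ (InnerProductSpace.rankOne ℂ x y) =
      InnerProductSpace.rankOne ℂ (σ x) (σ y) := by
  ext z
  simp only [antiunitaryConj_apply, InnerProductSpace.rankOne_apply, map_smulₛₗ, inner_conj_symm]
  rw [antiunitary_inner_symm_left]

lemma antiunitaryConj_nonneg [CompleteSpace H] {T : H →L[ℂ] H} (hT : 0 ≤ T) :
    0 ≤ antiunitaryConj σ T := by
  have h : T = star (CFC.sqrt T) * CFC.sqrt T := by
    rw [(CFC.sqrt_nonneg T).isSelfAdjoint.star_eq, CFC.sqrt_mul_sqrt_self T]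
  rw [h, antiunitaryConj_mul, antiunitaryConj_star]
  exact star_mul_self_nonneg _

lemma IsStarProjection.antiunitaryConj [CompleteSpace H] {P : H →L[ℂ] H}
    (hP : IsStarProjection P) : IsStarProjection (antiunitaryConj σ P) where
  isIdempotentElem := by
    rw [IsIdempotentElem, ← antiunitaryConj_mul, hP.isIdempotentElem.eq]
  isSelfAdjoint := by
    rw [IsSelfAdjoint, ← antiunitaryConj_star, hP.isSelfAdjoint.star_eq]

variable {σ}

lemma IsOddTimeReversal.symm_apply (hσ : IsOddTimeReversal σ) (x : H) : σ.symm x = -σ x := by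
  rw [σ.symm_apply_eq, map_neg, hσ, neg_neg]

lemma IsOddTimeReversal.antiunitaryConj_antiunitaryConj (hσ : IsOddTimeReversal σ)
    (T : H →L[ℂ] H) : antiunitaryConj σ (antiunitaryConj σ T) = T := by
  ext x
  simp [hσ.symm_apply, hσ _]

lemma IsOddTimeReversal.apply_map_of_antiunitaryConj_apply (hσ : IsOddTimeReversal σ)
    {P : H →L[ℂ] H} {x : H} (hx : antiunitaryConj σ P x = x) : P (σ x) = σ x := by
  rw [antiunitaryConj_apply, hσ.symm_apply, map_neg, map_neg, neg_eq_iff_eq_neg] at hx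
  rw [← neg_inj, ← hσ (P (σ x)), hx, map_neg]

variable (σ)

/-- The anti-unitary operator `x ↦ V (σ x)`. -/
noncomputable def antiunitaryTwist [CompleteSpace H] (V : unitary (H →L[ℂ] H)) :
    H ≃ₛₗᵢ[starRingEnd ℂ] H :=
  σ.trans (Unitary.linearIsometryEquiv V)

lemma antiunitaryTwist_apply [CompleteSpace H] (V : unitary (H →L[ℂ] H)) (x : H) :
    antiunitaryTwist σ V x = (V : H →L[ℂ] H) (σ x) := rfl

lemma antiunitaryConj_twist [CompleteSpace H] (V : unitary (H →L[ℂ] H)) (T : H →L[ℂ] H) :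
    antiunitaryConj (antiunitaryTwist σ V) T =
      (V : H →L[ℂ] H) * antiunitaryConj σ T * star (V : H →L[ℂ] H) := rfl

variable {σ}

/-- `(Vσ)² = V (σVσ*) σ² = -VV* = -1`. -/
lemma IsOddTimeReversal.twist [CompleteSpace H] (hσ : IsOddTimeReversal σ)
    (V : unitary (H →L[ℂ] H)) (hV : antiunitaryConj σ (V : H →L[ℂ] H) = star (V : H →L[ℂ] H)) :
    IsOddTimeReversal (antiunitaryTwist σ V) := by
  intro x
  have h : σ ((V : H →L[ℂ] H) (σ x)) = star (V : H →L[ℂ] H) (-x) := by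
    rw [← hV, antiunitaryConj_apply, hσ.symm_apply, map_neg σ, neg_neg]
  rw [antiunitaryTwist_apply, antiunitaryTwist_apply, h, ← mul_apply_eq_comp,
    Unitary.mul_star_self_of_mem V.2, one_apply_eq_self]

end AntiunitaryConj

/-! ### Kato's unitary intertwining two projections. -/

section Kato

lemma IsStarProjection.kato_mul_star {R : Type*} [Ring R] [StarRing R] {P Q : R}
    (hP : IsStarProjection P) (hQ : IsStarProjection Q) :
    (P * Q + (1 - P) * (1 - Q)) * star (P * Q + (1 - P) * (1 - Q)) =
      1 - (Q - P) * (Q - P) := by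
  have p1 := hP.isIdempotentElem.eq
  have q1 := hQ.isIdempotentElem.eq
  have q2 : ∀ x, Q * (Q * x) = Q * x := fun x => by rw [← mul_assoc, q1]
  simp only [star_add, star_mul, star_sub, star_one, hP.isSelfAdjoint.star_eq,
    hQ.isSelfAdjoint.star_eq, mul_add, add_mul, mul_sub, sub_mul, mul_one, one_mul, mul_assoc,
    p1, q1, q2]
  abel

lemma IsStarProjection.commute_sq_sub {R : Type*} [Ring R] [StarRing R] {P Q : R}
    (hP : IsStarProjection P) (hQ : IsStarProjection Q) :
    Commute (1 - (Q - P) * (Q - P)) P := by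
  have p1 := hP.isIdempotentElem.eq
  have q1 := hQ.isIdempotentElem.eq
  have p2 : ∀ x, P * (P * x) = P * x := fun x => by rw [← mul_assoc, p1]
  simp only [Commute, SemiconjBy, mul_sub, sub_mul, mul_one, one_mul, mul_assoc, p1, q1, p2]
  abel

lemma IsStarProjection.exists_units_mul_self_eq {R : Type*} [CStarAlgebra R] [PartialOrder R]
    [StarOrderedRing R] {P Q : R} (hP : IsStarProjection P) (hQ : IsStarProjection Q)
    (hunit : IsUnit (1 - (Q - P) * (Q - P))) :
    ∃ u : Rˣ, 0 ≤ (u : R) ∧ (u : R) * u = 1 - (Q - P) * (Q - P) ∧ star (↑u⁻¹ : R) = ↑u⁻¹ ∧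
      Commute (↑u⁻¹ : R) P ∧ Commute (↑u⁻¹ : R) Q := by
  have hswap : 1 - (P - Q) * (P - Q) = 1 - (Q - P) * (Q - P) := by
    rw [← neg_sub Q P, neg_mul_neg]
  have hBP := hP.commute_sq_sub hQ
  have hBQ : Commute (1 - (Q - P) * (Q - P)) Q := hswap ▸ hQ.commute_sq_sub hP
  have hB0 : 0 ≤ 1 - (Q - P) * (Q - P) := hP.kato_mul_star hQ ▸ mul_star_self_nonneg _
  generalize 1 - (Q - P) * (Q - P) = B at *
  obtain ⟨u, hu⟩ : IsUnit (CFC.sqrt B) := (CFC.isUnit_sqrt_iff B).2 hunit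
  have hu0 : 0 ≤ (u : R) := hu ▸ CFC.sqrt_nonneg B
  have hcomm : ∀ T : R, Commute B T → Commute (↑u⁻¹ : R) T := by
    intro T hT
    refine Commute.units_inv_left ?_
    rw [hu, CFC.sqrt_eq_cfc]
    exact hT.cfc_nnreal _
  refine ⟨u, hu0, by rw [hu, CFC.sqrt_mul_sqrt_self B], ?_, hcomm P hBP, hcomm Q hBQ⟩
  rw [← Units.coe_star, Units.val_inj, star_inv, inv_inj, ← Units.val_inj, Units.coe_star,
    hu0.isSelfAdjoint.star_eq]

/-- With `N = PQ + (1 - P)(1 - Q)`, both `1 - u = (Q - P)² (1 + u)⁻¹` and `N - 1 = P(Q - P) - (Q -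
P)Q` are exact algebraic identities. The ideal therefore need not be norm closed, which matters for
Schatten classes. -/
lemma IsStarProjection.kato_sub_one_mem {R : Type*} [CStarAlgebra R] [PartialOrder R]
    [StarOrderedRing R] {P Q : R} (hP : IsStarProjection P) (hQ : IsStarProjection Q)
    {u : Rˣ} (hu0 : 0 ≤ (u : R)) (huu : (u : R) * u = 1 - (Q - P) * (Q - P))
    (I : TwoSidedIdeal R) (hI : Q - P ∈ I) :
    (↑u⁻¹ : R) * (P * Q + (1 - P) * (1 - Q)) - 1 ∈ I := by
  obtain ⟨w, hw⟩ : IsUnit (1 + (u : R)) :=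
    CStarAlgebra.isUnit_of_le 1 (le_add_of_nonneg_right hu0) (by simp)
  have h1 : 1 - (u : R) = (Q - P) * (Q - P) * ↑w⁻¹ := by
    rw [Units.eq_mul_inv_iff_mul_eq, hw]
    have : (Q - P) * (Q - P) = 1 - (u : R) * u := by rw [huu, sub_sub_cancel]
    rw [this]
    noncomm_ring
  have h2 : P * Q + (1 - P) * (1 - Q) - 1 = P * (Q - P) - (Q - P) * Q := by
    have p1 := hP.isIdempotentElem.eq
    have q1 := hQ.isIdempotentElem.eq
    simp only [mul_sub, sub_mul, mul_one, one_mul, p1, q1]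
    abel
  have h3 : (↑u⁻¹ : R) * (P * Q + (1 - P) * (1 - Q)) - 1 =
      ↑u⁻¹ * ((P * Q + (1 - P) * (1 - Q) - 1) + (1 - u)) := by
    rw [sub_add_sub_cancel, mul_sub _ _ (u : R), u.inv_mul]
  rw [h3, h1, h2]
  exact I.mul_mem_left _ _ (I.add_mem (I.sub_mem (I.mul_mem_left _ _ hI)
    (I.mul_mem_right _ _ hI)) (I.mul_mem_right _ _ (I.mul_mem_left _ _ hI)))

lemma IsStarProjection.kato_mem_unitary {R : Type*} [Ring R] [StarRing R] {P Q : R}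
    (hP : IsStarProjection P) (hQ : IsStarProjection Q)
    {u : Rˣ} (huu : (u : R) * u = 1 - (Q - P) * (Q - P)) (hustar : star (↑u⁻¹ : R) = ↑u⁻¹)
    (hcP : Commute (↑u⁻¹ : R) P) (hcQ : Commute (↑u⁻¹ : R) Q) {N : R}
    (hN : N = P * Q + (1 - P) * (1 - Q)) :
    ↑u⁻¹ * N ∈ unitary R ∧ star (↑u⁻¹ * N) = ↑u⁻¹ * star N ∧
      ↑u⁻¹ * N * Q * star (↑u⁻¹ * N) = P := by
  have hNs : star N = Q * P + (1 - Q) * (1 - P) := by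
    simp [hN, hP.isSelfAdjoint.star_eq, hQ.isSelfAdjoint.star_eq]
  have hNN : N * star N = (u : R) * u := by rw [hN, huu]; exact hP.kato_mul_star hQ
  have hNN' : star N * N = (u : R) * u := by
    have h := hQ.kato_mul_star hP
    rw [← hNs, star_star, ← neg_sub Q P, neg_mul_neg] at h
    rw [h, huu]
  have hcN : Commute (↑u⁻¹ : R) N := by
    rw [hN]
    exact (hcP.mul_right hcQ).add_right
      (((Commute.one_right _).sub_right hcP).mul_right ((Commute.one_right _).sub_right hcQ))
  have hcNs : Commute (↑u⁻¹ : R) (star N) := by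
    have := hcN.star_star
    rwa [hustar] at this
  have hinv : (↑u⁻¹ : R) * ↑u⁻¹ * (u * u) = 1 := by
    rw [mul_assoc, u.inv_mul_cancel_left, u.inv_mul]
  have hstarV : star (↑u⁻¹ * N) = ↑u⁻¹ * star N := by rw [star_mul, hustar, hcNs.eq]
  have hVV : star ((↑u⁻¹ : R) * N) * (↑u⁻¹ * N) = 1 := by
    rw [hstarV, mul_assoc, ← mul_assoc (star N), ← hcNs.eq, mul_assoc, hNN', ← mul_assoc, hinv]
  have hVV' : (↑u⁻¹ : R) * N * star (↑u⁻¹ * N) = 1 := by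
    rw [hstarV, mul_assoc, ← mul_assoc N, ← hcN.eq, mul_assoc, hNN, ← mul_assoc, hinv]
  have hNQ : N * Q = P * N := by
    have p1 := hP.isIdempotentElem.eq
    have q1 := hQ.isIdempotentElem.eq
    have p2 : ∀ x, P * (P * x) = P * x := fun x => by rw [← mul_assoc, p1]
    simp only [hN, mul_add, add_mul, mul_sub, sub_mul, mul_one, one_mul, mul_assoc, p1, q1, p2]
    abel
  refine ⟨⟨hVV, hVV'⟩, hstarV, ?_⟩
  rw [mul_assoc (↑u⁻¹ : R) N Q, hNQ, ← mul_assoc (↑u⁻¹ : R) P N, hcP.eq,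
    mul_assoc P, mul_assoc P, hVV', mul_one]

variable {H : Type*} [NormedAddCommGroup H] [InnerProductSpace ℂ H] [CompleteSpace H]
  {σ : H ≃ₛₗᵢ[starRingEnd ℂ] H}

/-- Uniqueness of the positive square root: `σuσ*` is positive with the same square as `u`. -/
lemma antiunitaryConj_inv_of_nonneg {u : (H →L[ℂ] H)ˣ} (hu0 : 0 ≤ (u : H →L[ℂ] H))
    (h : antiunitaryConj σ ((u : H →L[ℂ] H) * u) = u * u) :
    antiunitaryConj σ (↑u⁻¹ : H →L[ℂ] H) = ↑u⁻¹ := by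
  have hu : antiunitaryConj σ (u : H →L[ℂ] H) = u := by
    rw [← CFC.sqrt_mul_self (u : H →L[ℂ] H) hu0]
    conv_rhs => rw [← h, antiunitaryConj_mul,
      CFC.sqrt_mul_self _ (antiunitaryConj_nonneg σ hu0)]
    rw [CFC.sqrt_mul_self (u : H →L[ℂ] H) hu0]
  refine (Units.inv_eq_of_mul_eq_one_right ?_).symm
  conv_lhs => rw [← hu]
  rw [← antiunitaryConj_mul, u.mul_inv, antiunitaryConj_one]

/-- The canonical unitary intertwining two projections `P` and `Q` for which `1 - (Q - P)²` is
invertible, when an anti-unitary operator exchanges these projections. -/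
theorem exists_unitary_intertwining_of_isUnit {P Q : H →L[ℂ] H} (hP : IsStarProjection P)
    (hQ : IsStarProjection Q) (hPQ : antiunitaryConj σ P = Q) (hQP : antiunitaryConj σ Q = P)
    (hunit : IsUnit (1 - (Q - P) * (Q - P))) :
    ∃ V ∈ unitary (H →L[ℂ] H), antiunitaryConj σ V = star V ∧ V * Q * star V = P ∧
      ∀ I : TwoSidedIdeal (H →L[ℂ] H), Q - P ∈ I → V - 1 ∈ I := by
  obtain ⟨u, hu0, huu, hustar, hcP, hcQ⟩ := hP.exists_units_mul_self_eq hQ hunit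
  obtain ⟨hV, hVstar, hVQ⟩ := hP.kato_mem_unitary hQ huu hustar hcP hcQ rfl
  refine ⟨_, hV, ?_, hVQ, hP.kato_sub_one_mem hQ hu0 huu⟩
  have huσ : antiunitaryConj σ (↑u⁻¹ : H →L[ℂ] H) = ↑u⁻¹ := by
    refine antiunitaryConj_inv_of_nonneg hu0 ?_
    rw [huu, antiunitaryConj_sub, antiunitaryConj_one, antiunitaryConj_mul, antiunitaryConj_sub,
      hPQ, hQP, ← neg_sub Q P, neg_mul_neg]
  -- Exchanging `P` and `Q` turns `PQ + (1 - P)(1 - Q)` into its adjoint.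
  rw [hVstar, antiunitaryConj_mul, huσ]
  simp only [antiunitaryConj_add, antiunitaryConj_mul, antiunitaryConj_sub, antiunitaryConj_one,
    hPQ, hQP, star_add, star_mul, star_sub, star_one, hP.isSelfAdjoint.star_eq,
    hQ.isSelfAdjoint.star_eq]

end Kato

/-! ### Transport when the kernel has dimension 0 or 1. -/

section Transport

open InnerProductSpace (rankOne)

variable {H : Type*} [NormedAddCommGroup H] [InnerProductSpace ℂ H] [CompleteSpace H]

lemma IsStarProjection.inner_apply_left {P : H →L[ℂ] H} (hP : IsStarProjection P) (x y : H) :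
    inner ℂ (P x) y = inner ℂ x (P y) := by
  rw [← ContinuousLinearMap.adjoint_inner_right, ← ContinuousLinearMap.star_eq_adjoint,
    hP.isSelfAdjoint.star_eq]

lemma IsStarProjection.apply_apply {P : H →L[ℂ] H} (hP : IsStarProjection P) (x : H) :
    P (P x) = P x := congr($(hP.isIdempotentElem.eq) x)

/-- Applying `Q` to `Qx - Px = x` gives `QPx = 0`; pairing the equation with `Px` then yields
`-‖Px‖² = ‖Px‖²`. -/
lemma IsStarProjection.mem_ker_sub_sub_one {P Q : H →L[ℂ] H} (hP : IsStarProjection P)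
    (hQ : IsStarProjection Q) {x : H} :
    x ∈ ((Q - P - 1 : H →L[ℂ] H) : H →ₗ[ℂ] H).ker ↔ Q x = x ∧ P x = 0 := by
  have hmem : x ∈ ((Q - P - 1 : H →L[ℂ] H) : H →ₗ[ℂ] H).ker ↔ Q x - P x = x := by
    simp [LinearMap.mem_ker, sub_eq_zero]
  rw [hmem]
  refine ⟨fun h => ?_, fun ⟨h1, h2⟩ => by rw [h1, h2, sub_zero]⟩
  have hQP : Q (P x) = 0 := by
    have := congr(Q $h)
    rwa [map_sub, hQ.apply_apply, sub_eq_self] at this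
  have hP0 : P x = 0 := by
    rw [← inner_self_eq_zero (𝕜 := ℂ)]
    have h1 : inner ℂ (Q x) (P x) = 0 := by rw [hQ.inner_apply_left, hQP, inner_zero_right]
    have h2 : inner ℂ x (P x) = inner ℂ (P x) (P x) := by
      rw [hP.inner_apply_left, hP.apply_apply]
    have h3 : inner ℂ (Q x - P x) (P x) = inner ℂ x (P x) := by rw [h]
    rw [inner_sub_left, h1, h2, zero_sub, neg_eq_iff_add_eq_zero, ← two_mul] at h3
    simpa using h3
  exact ⟨by rwa [hP0, sub_zero] at h, hP0⟩

lemma finiteDimensional_ker_sub_one {A : H →L[ℂ] H} (hA : IsCompactOperator A) :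
    FiniteDimensional ℂ ((A - 1 : H →L[ℂ] H) : H →ₗ[ℂ] H).ker := by
  have h := ContinuousLinearMap.finite_dimensional_eigenspace hA 1 one_ne_zero
  have hker : ((A - 1 : H →L[ℂ] H) : H →ₗ[ℂ] H).ker = Module.End.eigenspace (A : H →ₗ[ℂ] H) 1 := by
    ext x
    simp [LinearMap.mem_ker, sub_eq_zero]
  rw [hker]
  exact h

lemma IsCompactOperator.isUnit_one_sub {A : H →L[ℂ] H} (hA : IsCompactOperator A)
    (h : ∀ x, A x = x → x = 0) : IsUnit (1 - A) := by
  rcases hA.hasEigenvalue_or_mem_resolventSet (one_ne_zero (α := ℂ)) with h1 | h1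
  · obtain ⟨x, hx⟩ := h1.exists_hasEigenvector
    exact absurd (h x (by simpa using hx.apply_eq_smul)) hx.2
  · simpa [spectrum.mem_resolventSet_iff] using h1

lemma isOneDimProjection_rankOne {x : H} (hx : ‖x‖ = 1) : IsOneDimProjection (rankOne ℂ x x) := by
  refine ⟨InnerProductSpace.isStarProjection_rankOne_self hx, ?_⟩
  have hx0 : x ≠ 0 := by rintro rfl; simp at hx
  rw [← Module.rank_eq_one_iff_finrank_eq_one]
  exact InnerProductSpace.rank_rankOne hx0 hx0

/-- A unitary `V`, equivariant under `σ`, that transports `σ P σ*` to `P` up to an error of the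
form allowed by the parity of `n`. It differs from `1` by an element of the ideal generated by
`σ P σ* - P` and the operators of rank one. -/
def IsEquivariantTransport (σ : H ≃ₛₗᵢ[starRingEnd ℂ] H) (P : H →L[ℂ] H) (n : ℕ)
    (V : H →L[ℂ] H) : Prop :=
  V ∈ unitary (H →L[ℂ] H) ∧ antiunitaryConj σ V = star V ∧
    (∀ I : TwoSidedIdeal (H →L[ℂ] H), (∀ x y : H, rankOne ℂ x y ∈ I) →
      antiunitaryConj σ P - P ∈ I → V - 1 ∈ I) ∧
    (Even n → V * antiunitaryConj σ P * star V - P = 0) ∧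
    (Odd n → ∃ Rplus Rminus : H →L[ℂ] H, IsOneDimProjection Rplus ∧ IsOneDimProjection Rminus ∧
      V * antiunitaryConj σ P * star V - P = Rplus - Rminus)

variable {σ : H ≃ₛₗᵢ[starRingEnd ℂ] H} {P : H →L[ℂ] H}

/-- Since `σAσ* = -A`, neither `1` nor `-1` is an eigenvalue of `A`, and the Fredholm alternative
inverts both factors of `1 - A² = (1 - A)(1 + A)`. -/
lemma exists_intertwining_of_ker_eq_bot (hσ : IsOddTimeReversal σ) (hP : IsStarProjection P)
    (hA : IsCompactOperator (antiunitaryConj σ P - P))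
    (hker : ((antiunitaryConj σ P - P - 1 : H →L[ℂ] H) : H →ₗ[ℂ] H).ker = ⊥) :
    ∃ V ∈ unitary (H →L[ℂ] H), antiunitaryConj σ V = star V ∧
      V * antiunitaryConj σ P * star V = P ∧
      ∀ I : TwoSidedIdeal (H →L[ℂ] H), antiunitaryConj σ P - P ∈ I → V - 1 ∈ I := by
  have hQ := hP.antiunitaryConj σ
  have hQP := hσ.antiunitaryConj_antiunitaryConj P
  refine exists_unitary_intertwining_of_isUnit hP hQ rfl hQP ?_
  have hAσ : antiunitaryConj σ (antiunitaryConj σ P - P) = -(antiunitaryConj σ P - P) := by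
    rw [antiunitaryConj_sub, hQP, neg_sub]
  generalize antiunitaryConj σ P - P = A at *
  have h1 : ∀ x, A x = x → x = 0 := fun x hx => by
    rw [← Submodule.mem_bot ℂ, ← hker]
    simp [LinearMap.mem_ker, hx]
  have h2 : ∀ x, (-A) x = x → x = 0 := fun x hx => by
    rw [← hAσ, antiunitaryConj_apply] at hx
    have := h1 (σ.symm x) (by rw [σ.eq_symm_apply, hx])
    simpa using this
  have hfac : 1 - A * A = (1 - A) * (1 - -A) := by noncomm_ring
  rw [hfac]
  exact (hA.isUnit_one_sub h1).mul (IsCompactOperator.isUnit_one_sub (A := -A) hA.neg h2)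

/-- For a unit vector `e` of the kernel, `e` lies in the range of `Q` and `f = σe` in that of `P`.
Removing `f` from `P` removes `e` from `Q` and empties the kernel; putting both back after the
transport leaves the projections onto `Ve` and `f`. -/
lemma exists_isEquivariantTransport_one (hσ : IsOddTimeReversal σ) (hP : IsStarProjection P)
    (hA : IsCompactOperator (antiunitaryConj σ P - P))
    (hker : Module.finrank ℂ
      ((antiunitaryConj σ P - P - 1 : H →L[ℂ] H) : H →ₗ[ℂ] H).ker = 1) :
    ∃ V, IsEquivariantTransport σ P 1 V := by
  have hQ := hP.antiunitaryConj σ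
  have hmem := fun x : H => hP.mem_ker_sub_sub_one hQ (x := x)
  set E := ((antiunitaryConj σ P - P - 1 : H →L[ℂ] H) : H →ₗ[ℂ] H).ker with hE
  have hfin : FiniteDimensional ℂ E := finiteDimensional_ker_sub_one hA
  obtain ⟨e, he, hespan⟩ : ∃ e ∈ E, ‖e‖ = 1 ∧ ∀ x ∈ E, ∃ c : ℂ, c • e = x := by
    let b := stdOrthonormalBasis ℂ E
    let i : Fin (Module.finrank ℂ E) := ⟨0, by omega⟩
    have hb : ‖b i‖ = 1 := b.orthonormal.1 i
    refine ⟨b i, (b i).2, hb, fun x hx => ?_⟩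
    have hb0 : b i ≠ 0 := by intro h; simp [h] at hb
    obtain ⟨c, hc⟩ := (finrank_eq_one_iff_of_nonzero' (b i) hb0).1 hker ⟨x, hx⟩
    exact ⟨c, congr(Subtype.val $hc)⟩
  obtain ⟨hne, hespan⟩ := hespan
  obtain ⟨hQe, hPe⟩ := (hmem e).1 he
  have hPf := hσ.apply_map_of_antiunitaryConj_apply hQe
  have hnf : ‖σ e‖ = 1 := by rw [σ.norm_map, hne]
  set f := σ e with hf
  have hfproj := InnerProductSpace.isStarProjection_rankOne_self (𝕜 := ℂ) hnf
  have hP' : IsStarProjection (P - rankOne ℂ f f) := by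
    refine hfproj.sub_of_mul_eq_right hP ?_
    ext x
    simp [hPf]
  have hQ' : antiunitaryConj σ (P - rankOne ℂ f f) = antiunitaryConj σ P - rankOne ℂ e e := by
    rw [antiunitaryConj_sub, antiunitaryConj_rankOne, hf, hσ e]
    simp
  have hdiff : antiunitaryConj σ (P - rankOne ℂ f f) - (P - rankOne ℂ f f) =
      (antiunitaryConj σ P - P) - rankOne ℂ e e + rankOne ℂ f f := by rw [hQ']; abel
  have hI : ∀ I : TwoSidedIdeal (H →L[ℂ] H), (∀ x y : H, rankOne ℂ x y ∈ I) →
      antiunitaryConj σ P - P ∈ I →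
      antiunitaryConj σ (P - rankOne ℂ f f) - (P - rankOne ℂ f f) ∈ I := fun I h1 h2 => by
    rw [hdiff]
    exact I.add_mem (I.sub_mem h2 (h1 e e)) (h1 f f)
  have hA' := mem_compactIdeal.1
    (hI (compactIdeal H) rankOne_mem_compactIdeal (mem_compactIdeal.2 hA))
  have hker' : ((antiunitaryConj σ (P - rankOne ℂ f f) - (P - rankOne ℂ f f) - 1 :
      H →L[ℂ] H) : H →ₗ[ℂ] H).ker = ⊥ := by
    rw [Submodule.eq_bot_iff]
    intro x hx
    obtain ⟨h1, h2⟩ := (hP'.mem_ker_sub_sub_one (hP'.antiunitaryConj σ)).1 hx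
    rw [hQ', sub_apply, InnerProductSpace.rankOne_apply] at h1
    rw [sub_apply, InnerProductSpace.rankOne_apply, sub_eq_zero] at h2
    have hee : inner ℂ e e = (1 : ℂ) := by simp [inner_self_eq_norm_sq_to_K, hne]
    -- `Qx - ⟨e,x⟩e = x`, and the left side is orthogonal to `e`.
    have hex : inner ℂ e x = 0 := by
      have := congr(inner ℂ e $h1)
      rw [inner_sub_right, ← hQ.inner_apply_left, hQe, inner_smul_right, hee, mul_one,
        sub_self] at this
      exact this.symm
    rw [hex, zero_smul, sub_zero] at h1
    have hPx : P x = 0 := by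
      have hfx : inner ℂ f x = 0 := by
        have hQf : antiunitaryConj σ P f = 0 := by
          rw [antiunitaryConj_apply, hf, σ.symm_apply_apply, hPe, map_zero]
        rw [← h1, ← hQ.inner_apply_left, hQf, inner_zero_left]
      rw [h2, hfx, zero_smul]
    obtain ⟨c, rfl⟩ := hespan x ((hmem x).2 ⟨h1, hPx⟩)
    rw [inner_smul_right, hee, mul_one] at hex
    rw [hex, zero_smul]
  obtain ⟨V, hV, hVσ, hVQ, hVI⟩ := exists_intertwining_of_ker_eq_bot hσ hP' hA' hker'
  refine ⟨V, hV, hVσ, fun I h1 h2 => hVI I (hI I h1 h2), fun h => absurd h (by decide), fun _ => ?_⟩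
  refine ⟨rankOne ℂ (V e) (V e), rankOne ℂ f f, isOneDimProjection_rankOne ?_,
    isOneDimProjection_rankOne hnf, ?_⟩
  · rw [ContinuousLinearMap.norm_map_of_mem_unitary hV, hne]
  · have h1 : V * rankOne ℂ e e * star V = rankOne ℂ (V e) (V e) := by
      ext x
      simp [ContinuousLinearMap.star_eq_adjoint, ContinuousLinearMap.adjoint_inner_right]
    rw [hQ', mul_sub, sub_mul, h1, sub_eq_iff_eq_add] at hVQ
    rw [hVQ]
    abel

end Transport

/-! ### Lowering the kernel dimension by two. -/

section Reduction

open InnerProductSpace (rankOne)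

variable {H : Type*} [NormedAddCommGroup H] [InnerProductSpace ℂ H]

/-- The reflection in the orthogonal complement of two orthogonal vectors of square norm two. -/
noncomputable def doubleReflection (a b : H) : H →L[ℂ] H := 1 - rankOne ℂ a a - rankOne ℂ b b

lemma doubleReflection_apply (a b x : H) :
    doubleReflection a b x = x - inner ℂ a x • a - inner ℂ b x • b := rfl

lemma doubleReflection_mul_self {a b : H} (ha : inner ℂ a a = (2 : ℂ)) (hb : inner ℂ b b = (2 : ℂ))
    (hab : inner ℂ a b = (0 : ℂ)) : doubleReflection a b * doubleReflection a b = 1 := by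
  have hba : inner ℂ b a = (0 : ℂ) := inner_eq_zero_symm.1 hab
  ext x
  simp only [mul_apply_eq_comp, doubleReflection_apply, inner_sub_right, inner_smul_right, ha, hb,
    hab, hba, one_apply_eq_self]
  module

lemma antiunitaryConj_doubleReflection (σ : H ≃ₛₗᵢ[starRingEnd ℂ] H) (a b : H) :
    antiunitaryConj σ (doubleReflection a b) = doubleReflection (σ a) (σ b) := by
  simp only [doubleReflection, antiunitaryConj_sub, antiunitaryConj_one, antiunitaryConj_rankOne]

lemma doubleReflection_mem_ideal (a b : H) (I : TwoSidedIdeal (H →L[ℂ] H))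
    (hI : ∀ x y : H, rankOne ℂ x y ∈ I) : doubleReflection a b - 1 ∈ I := by
  have h : doubleReflection a b - 1 = -rankOne ℂ a a - rankOne ℂ b b := by
    rw [doubleReflection]; abel
  rw [h]
  exact I.sub_mem (I.neg_mem (hI a a)) (hI b b)

variable [CompleteSpace H]

lemma star_doubleReflection (a b : H) : star (doubleReflection a b) = doubleReflection a b := by
  simp [doubleReflection, ContinuousLinearMap.star_eq_adjoint]

/-- `(VR) Q (VR)* = V (RQR*) V*`, and `RQR*` is the conjugate of `P` by `Rσ`. Raising `n` by two
keeps its parity. -/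
lemma IsEquivariantTransport.of_twist {σ : H ≃ₛₗᵢ[starRingEnd ℂ] H} {P V : H →L[ℂ] H} {n : ℕ}
    {R : unitary (H →L[ℂ] H)} (hRstar : star (R : H →L[ℂ] H) = R)
    (hRσ : antiunitaryConj σ (R : H →L[ℂ] H) = R)
    (hRI : ∀ I : TwoSidedIdeal (H →L[ℂ] H), (∀ x y : H, rankOne ℂ x y ∈ I) →
      (R : H →L[ℂ] H) - 1 ∈ I ∧ (antiunitaryConj σ P - P ∈ I →
        antiunitaryConj (antiunitaryTwist σ R) P - P ∈ I))
    (hV : IsEquivariantTransport (antiunitaryTwist σ R) P n V) :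
    IsEquivariantTransport σ P (n + 2) (V * R) := by
  obtain ⟨hVu, hVσ, hVI, heven, hodd⟩ := hV
  have hRR : (R : H →L[ℂ] H) * R = 1 := by
    have h := Unitary.star_mul_self_of_mem R.2
    rwa [hRstar] at h
  have hconj : V * R * antiunitaryConj σ P * star (V * R) =
      V * antiunitaryConj (antiunitaryTwist σ R) P * star V := by
    rw [antiunitaryConj_twist, star_mul]
    simp only [mul_assoc]
  refine ⟨mul_mem hVu R.2, ?_, fun I h1 h2 => ?_, fun h => ?_, fun h => ?_⟩
  · rw [antiunitaryConj_twist, hRstar] at hVσ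
    rw [antiunitaryConj_mul, hRσ, star_mul, hRstar, ← hVσ]
    simp only [← mul_assoc, hRR, one_mul]
  · have h3 : V * R - 1 = (V - 1) * R + ((R : H →L[ℂ] H) - 1) := by noncomm_ring
    rw [h3]
    exact I.add_mem (I.mul_mem_right _ _ (hVI I h1 ((hRI I h1).2 h2))) (hRI I h1).1
  · rw [hconj]
    exact heven (by simpa [Nat.even_add] using h)
  · rw [hconj]
    exact hodd (by simpa [Nat.odd_add] using h)

variable {σ : H ≃ₛₗᵢ[starRingEnd ℂ] H} {P : H →L[ℂ] H}

/-- If `σ P σ* - P` has two orthonormal eigenvectors for the eigenvalue `1`, a reflection that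
commutes with `σ` removes them from this eigenspace. -/
lemma exists_twist_ker_eq (hσ : IsOddTimeReversal σ) (hP : IsStarProjection P) {v : Fin 2 → H}
    (hv : Orthonormal ℂ v)
    (hvker : ∀ i, v i ∈ ((antiunitaryConj σ P - P - 1 : H →L[ℂ] H) : H →ₗ[ℂ] H).ker) :
    ∃ R : unitary (H →L[ℂ] H), star (R : H →L[ℂ] H) = R ∧
      antiunitaryConj σ (R : H →L[ℂ] H) = R ∧
      (∀ I : TwoSidedIdeal (H →L[ℂ] H), (∀ x y : H, rankOne ℂ x y ∈ I) →
        (R : H →L[ℂ] H) - 1 ∈ I) ∧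
      ((antiunitaryConj (antiunitaryTwist σ R) P - P - 1 : H →L[ℂ] H) : H →ₗ[ℂ] H).ker =
        (Submodule.span ℂ (Set.range v))ᗮ ⊓
          ((antiunitaryConj σ P - P - 1 : H →L[ℂ] H) : H →ₗ[ℂ] H).ker := by
  have hQ := hP.antiunitaryConj σ
  have hQv : ∀ i, antiunitaryConj σ P (v i) = v i := fun i =>
    ((hP.mem_ker_sub_sub_one hQ).1 (hvker i)).1
  have hPv : ∀ i, P (v i) = 0 := fun i => ((hP.mem_ker_sub_sub_one hQ).1 (hvker i)).2
  have hPf : ∀ i, P (σ (v i)) = σ (v i) := fun i =>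
    hσ.apply_map_of_antiunitaryConj_apply (hQv i)
  have hQf : ∀ i, antiunitaryConj σ P (σ (v i)) = 0 := fun i => by
    rw [antiunitaryConj_apply, σ.symm_apply_apply, hPv, map_zero]
  have hvv : ∀ i j, inner ℂ (v i) (v j) = if i = j then (1 : ℂ) else 0 :=
    orthonormal_iff_ite.1 hv
  have hff : ∀ i j, inner ℂ (σ (v i)) (σ (v j)) = if j = i then (1 : ℂ) else 0 := fun i j => by
    rw [antiunitary_inner_map_map, hvv]
  have hfv : ∀ i j, inner ℂ (σ (v i)) (v j) = (0 : ℂ) := fun i j => by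
    rw [← hPf, hP.inner_apply_left, hPv, inner_zero_right]
  have hvf : ∀ i j, inner ℂ (v i) (σ (v j)) = (0 : ℂ) := fun i j => inner_eq_zero_symm.1 (hfv j i)
  -- The signs are chosen so that `σ` permutes the lines of `a` and `b`, using `σ² = -1`; hence the
  -- reflection commutes with `σ`. It sends `σ v₀` to `v₁` and `σ v₁` to `-v₀`.
  set a := σ (v 0) - v 1 with ha
  set b := σ (v 1) + v 0 with hb
  have hσa : σ a = -b := by rw [ha, hb, map_sub, hσ]; abel
  have hσb : σ b = a := by rw [ha, hb, map_add, hσ]; abel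
  set T := doubleReflection a b with hT
  have hTT : T * T = 1 := by
    apply doubleReflection_mul_self
    · simp only [ha, inner_sub_left, inner_sub_right, hff, hfv, hvf, hvv, if_true]; norm_num
    · simp only [hb, inner_add_left, inner_add_right, hff, hfv, hvf, hvv, if_true]; norm_num
    · simp [ha, hb, inner_sub_left, inner_add_right, hff, hfv, hvf, hvv]
  have hTs : star T = T := star_doubleReflection a b
  have hTσ : antiunitaryConj σ T = T := by
    rw [hT, antiunitaryConj_doubleReflection, hσa, hσb]
    ext x
    simp only [doubleReflection_apply, inner_neg_left]
    module
  have hTu : T ∈ unitary (H →L[ℂ] H) := ⟨by rw [hTs, hTT], by rw [hTs, hTT]⟩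
  have hTTx : ∀ x, T (T x) = x := fun x => congr($hTT x)
  have hTinner : ∀ x y, inner ℂ (T x) y = inner ℂ x (T y) := fun x y => by
    rw [← ContinuousLinearMap.adjoint_inner_right, ← ContinuousLinearMap.star_eq_adjoint, hTs]
  have hTf0 : T (σ (v 0)) = v 1 := by
    rw [hT, doubleReflection_apply]
    simp [-inner_self_eq_norm_sq_to_K, ha, hb, inner_sub_left, inner_add_left, hff, hvf]
  have hTf1 : T (σ (v 1)) = -v 0 := by
    rw [hT, doubleReflection_apply]
    simp [-inner_self_eq_norm_sq_to_K, ha, hb, inner_sub_left, inner_add_left, hff, hvf]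
  have hTfix : ∀ x, (∀ i, inner ℂ (v i) x = 0) → P x = 0 → T x = x := fun x h1 h2 => by
    have h3 : ∀ i, inner ℂ (σ (v i)) x = 0 := fun i => by
      rw [← hPf, hP.inner_apply_left, h2, inner_zero_right]
    rw [hT, doubleReflection_apply]
    simp [ha, hb, inner_sub_left, inner_add_left, h1, h3]
  refine ⟨⟨T, hTu⟩, hTs, hTσ, doubleReflection_mem_ideal a b, ?_⟩
  ext x
  rw [hP.mem_ker_sub_sub_one (hP.antiunitaryConj _), Submodule.mem_inf, hP.mem_ker_sub_sub_one hQ,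
    antiunitaryConj_twist, hTs]
  have horth : x ∈ (Submodule.span ℂ (Set.range v))ᗮ ↔ ∀ i, inner ℂ (v i) x = 0 := by
    refine ⟨fun h i => h (v i) (Submodule.subset_span ⟨i, rfl⟩), fun h y hy => ?_⟩
    have hle : Submodule.span ℂ (Set.range v) ≤ (Submodule.span ℂ {x})ᗮ :=
      Submodule.span_le.2 (Set.range_subset_iff.2 fun i =>
        Submodule.mem_orthogonal_singleton_iff_inner_left.2 (h i))
    exact Submodule.mem_orthogonal_singleton_iff_inner_left.1 (hle hy)
  rw [horth]
  change T (antiunitaryConj σ P (T x)) = x ∧ P x = 0 ↔ _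
  constructor
  · rintro ⟨h1, h2⟩
    have hQT : antiunitaryConj σ P (T x) = T x := by rw [← hTTx (antiunitaryConj σ P (T x)), h1]
    -- `Tx` is in the range of `Q` while `σ vᵢ` is in its kernel; up to sign the vectors `T(σ vᵢ)`
    -- are `v₁` and `v₀`.
    have h3 : ∀ i, inner ℂ (T (σ (v i))) x = 0 := fun i => by
      rw [hTinner, ← hQT, ← hQ.inner_apply_left, hQf, inner_zero_left]
    have h4 : ∀ i, inner ℂ (v i) x = 0 := by
      rw [Fin.forall_fin_two]
      exact ⟨by simpa [hTf1] using h3 1, by simpa [hTf0] using h3 0⟩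
    rw [hTfix x h4 h2] at hQT
    exact ⟨h4, hQT, h2⟩
  · rintro ⟨h1, h2, h3⟩
    rw [hTfix x h1 h3, h2, hTfix x h1 h3]
    exact ⟨rfl, h3⟩

/-- The induction keeps `P` fixed but must range over all `σ`, since each reduction replaces `σ` by
`Rσ`. -/
theorem exists_isEquivariantTransport (n : ℕ) : ∀ (σ : H ≃ₛₗᵢ[starRingEnd ℂ] H),
    IsOddTimeReversal σ → IsStarProjection P → IsCompactOperator (antiunitaryConj σ P - P) →
    Module.finrank ℂ ((antiunitaryConj σ P - P - 1 : H →L[ℂ] H) : H →ₗ[ℂ] H).ker = n →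
    ∃ V, IsEquivariantTransport σ P n V := by
  induction n using Nat.twoStepInduction with
  | zero =>
    intro σ hσ hP hA hn
    have hfin := finiteDimensional_ker_sub_one hA
    obtain ⟨V, hV, hVσ, hVQ, hVI⟩ :=
      exists_intertwining_of_ker_eq_bot hσ hP hA (Submodule.finrank_eq_zero.1 hn)
    exact ⟨V, hV, hVσ, fun I _ h => hVI I h, fun _ => by rw [hVQ, sub_self],
      fun h => absurd h (by decide)⟩
  | one => exact fun σ hσ hP hA hn => exists_isEquivariantTransport_one hσ hP hA hn
  | more n ih _ =>
    intro σ hσ hP hA hn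
    have hfin := finiteDimensional_ker_sub_one hA
    obtain ⟨v, hv, hvker⟩ : ∃ v : Fin 2 → H, Orthonormal ℂ v ∧
        ∀ i, v i ∈ ((antiunitaryConj σ P - P - 1 : H →L[ℂ] H) : H →ₗ[ℂ] H).ker := by
      let b := stdOrthonormalBasis ℂ
        ((antiunitaryConj σ P - P - 1 : H →L[ℂ] H) : H →ₗ[ℂ] H).ker
      have hle : 2 ≤ Module.finrank ℂ
        ((antiunitaryConj σ P - P - 1 : H →L[ℂ] H) : H →ₗ[ℂ] H).ker := by omega
      exact ⟨fun i => b (Fin.castLE hle i),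
        (b.orthonormal.comp _ (Fin.castLE_injective hle)).comp_linearIsometry
          (Submodule.subtypeₗᵢ _), fun i => (b (Fin.castLE hle i)).2⟩
    obtain ⟨R, hRs, hRσ, hRI, hRker⟩ := exists_twist_ker_eq hσ hP hv hvker
    have hRI' : ∀ I : TwoSidedIdeal (H →L[ℂ] H), (∀ x y : H, rankOne ℂ x y ∈ I) →
        (R : H →L[ℂ] H) - 1 ∈ I ∧ (antiunitaryConj σ P - P ∈ I →
          antiunitaryConj (antiunitaryTwist σ R) P - P ∈ I) := fun I h1 => by
      refine ⟨hRI I h1, fun h2 => ?_⟩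
      have h3 : antiunitaryConj (antiunitaryTwist σ R) P - P =
          ((R : H →L[ℂ] H) - 1) * antiunitaryConj σ P * R +
            antiunitaryConj σ P * ((R : H →L[ℂ] H) - 1) + (antiunitaryConj σ P - P) := by
        rw [antiunitaryConj_twist, hRs]
        noncomm_ring
      rw [h3]
      exact I.add_mem (I.add_mem (I.mul_mem_right _ _ (I.mul_mem_right _ _ (hRI I h1)))
        (I.mul_mem_left _ _ (hRI I h1))) h2
    have hdim : Module.finrank ℂ ((antiunitaryConj (antiunitaryTwist σ R) P - P - 1 :
        H →L[ℂ] H) : H →ₗ[ℂ] H).ker = n := by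
      have hle : Submodule.span ℂ (Set.range v) ≤
          ((antiunitaryConj σ P - P - 1 : H →L[ℂ] H) : H →ₗ[ℂ] H).ker :=
        Submodule.span_le.2 (Set.range_subset_iff.2 hvker)
      have h1 := Submodule.finrank_add_inf_finrank_orthogonal hle
      rw [finrank_span_eq_card hv.linearIndependent, Fintype.card_fin, hn] at h1
      rw [hRker]
      omega
    have hA' := mem_compactIdeal.1
      ((hRI' (compactIdeal H) rankOne_mem_compactIdeal).2 (mem_compactIdeal.2 hA))
    obtain ⟨V, hV⟩ := ih (antiunitaryTwist σ R)
      (hσ.twist R (hRσ.trans hRs.symm)) hP hA' hdim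
    exact ⟨V * R, hV.of_twist hRs hRσ hRI'⟩

end Reduction

/-! ### The main theorem, with `σ = Uτ`. -/

theorem proposition4 {H : Type*} [NormedAddCommGroup H] [InnerProductSpace ℂ H] [CompleteSpace H]
    (U P A : H →L[ℂ] H) (τ : H ≃ₛₗᵢ[starRingEnd ℂ] H)
    (hU : U ∈ unitary (H →L[ℂ] H)) (hP : IsStarProjection P)
    (hA : A = U * P * star U - P) (hAcompact : IsCompactOperator A)
    (hτ : IsOddTimeReversal τ)
    (hτU : antiunitaryConj τ U = star U) (hτP : antiunitaryConj τ P = P) :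
    ∃ V ∈ unitary (H →L[ℂ] H), ∃ W ∈ unitary (H →L[ℂ] H),
      W = V * U ∧
      IsCompactOperator (U - W) ∧
      antiunitaryConj τ W = star W ∧
      (Even (Module.finrank ℂ ((A - 1 : H →L[ℂ] H) : H →ₗ[ℂ] H).ker) →
        W * P * star W - P = 0) ∧
      (Odd (Module.finrank ℂ ((A - 1 : H →L[ℂ] H) : H →ₗ[ℂ] H).ker) →
        ∃ Rplus Rminus : H →L[ℂ] H,
          IsOneDimProjection Rplus ∧ IsOneDimProjection Rminus ∧
          W * P * star W - P = Rplus - Rminus) ∧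
      (∀ p : ℝ, 0 < p → IsSchatten p (U * P - P * U) → IsSchatten p (U - W)) := by
  have hσ : IsOddTimeReversal (antiunitaryTwist τ ⟨U, hU⟩) := hτ.twist ⟨U, hU⟩ hτU
  have hQ : antiunitaryConj (antiunitaryTwist τ ⟨U, hU⟩) P = U * P * star U := by
    rw [antiunitaryConj_twist, hτP]
  have hUU : U * star U = 1 := Unitary.mul_star_self_of_mem hU
  have hUU' : star U * U = 1 := Unitary.star_mul_self_of_mem hU
  have hAσ : A = antiunitaryConj (antiunitaryTwist τ ⟨U, hU⟩) P - P := by rw [hQ, hA]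
  obtain ⟨V, hV, hVσ, hVI, heven, hodd⟩ := exists_isEquivariantTransport _ _ hσ hP
    (hAσ ▸ hAcompact) rfl
  rw [← hAσ] at hVI heven hodd
  rw [antiunitaryConj_twist] at hVσ
  have hconj : V * U * P * star (V * U) = V * (U * P * star U) * star V := by
    simp only [star_mul, mul_assoc]
  have hdiff : U - V * U = -((V - 1) * U) := by noncomm_ring
  have hideal : ∀ I : TwoSidedIdeal (H →L[ℂ] H),
      (∀ x y : H, InnerProductSpace.rankOne ℂ x y ∈ I) → A ∈ I → U - V * U ∈ I := fun I h1 h2 => by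
    rw [hdiff]
    exact I.neg_mem (I.mul_mem_right _ _ (hVI I h1 h2))
  refine ⟨V, hV, V * U, mul_mem hV hU, rfl, mem_compactIdeal.1
    (hideal _ rankOne_mem_compactIdeal (mem_compactIdeal.2 hAcompact)), ?_, fun h => ?_,
    fun h => ?_, fun p hp h => ?_⟩
  · rw [antiunitaryConj_mul, hτU, star_mul, ← hVσ]
    simp only [← mul_assoc, hUU', one_mul]
  · rw [hconj, ← hQ]
    exact heven h
  · rw [hconj, ← hQ]
    exact hodd h
  · refine mem_schattenIdeal.1 (hideal (schattenIdeal H p hp) (rankOne_mem_schattenIdeal hp) ?_)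
    -- The Schatten hypothesis on the commutator passes to `A`, because `A = [U,P] U*`.
    have hAcomm : A = (U * P - P * U) * star U := by
      rw [sub_mul, mul_assoc P, hUU, mul_one, hA]
    rw [hAcomm]
    exact TwoSidedIdeal.mul_mem_right _ _ _ (mem_schattenIdeal.2 h)
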